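/- Let $n$ be a natural number, let $\mathbb{M}_n$ be the algebra of $n\times n$ complex matrices, and let $|||\cdot|||$ be a unitarily invariant norm on $\mathbb{M}_n$, that is, a norm with $|||UXV|||=|||X|||$ for all $X\in\mathbb{M}_n$ and all unitary $U,V\in\mathbb{M}_n$. Let $A,B\in\mathbb{M}_n$ be positive definite (that is, $\langle Ax,x\rangle>0$ and $\langle Bx,x\rangle>0$ for all nonzero $x\in\mathbb{C}^n$) and let $X\in\mathbb{M}_n$ be arbitrary. For $\nu\in\mathbb{R}$ put $$f(\nu)=|||A^{\nu}XB^{1-\nu}+A^{1-\nu}XB^{\nu}|||,$$ where the real powers are defined by the functional calculus. Then $f$ is decreasing on $\left(-\infty,\tfrac12\right]$ and increasing on $\left[\tfrac12,\infty\right)$, both in the non-strict sense: $f(\nu_1)\ge f(\nu_2)$ whenever $\nu_1\le\nu_2\le\tfrac12$, and $f(\nu_1)\le f(\nu_2)$ whenever $\tfrac12\le\nu_1\le\nu_2$. -/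

import Mathlib

open scoped ComplexOrder MatrixOrder

/-- A norm `N` on the complex `n × n` matrices is unitarily invariant if `N (U X V) = N X` for
all unitary `U`, `V`. The field `eq_zero` says that the seminorm `N` is a norm. -/
structure IsUnitarilyInvariantNorm {n : ℕ} (N : Seminorm ℂ (Matrix (Fin n) (Fin n) ℂ)) :
    Prop where
  eq_zero : ∀ X : Matrix (Fin n) (Fin n) ℂ, N X = 0 → X = 0
  unitary_mul_mul : ∀ U ∈ Matrix.unitaryGroup (Fin n) ℂ, ∀ V ∈ Matrix.unitaryGroup (Fin n) ℂ,
    ∀ X : Matrix (Fin n) (Fin n) ℂ, N (U * X * V) = N X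

/-- The function `ν ↦ N (A ^ ν X B ^ (1 - ν) + A ^ (1 - ν) X B ^ ν)`. The real powers of `A` and
`B` are those of the continuous functional calculus, `CFC.rpow`. -/
noncomputable def heinzNorm {n : ℕ} (N : Seminorm ℂ (Matrix (Fin n) (Fin n) ℂ))
    (A B X : Matrix (Fin n) (Fin n) ℂ) (ν : ℝ) : ℝ :=
  N (A ^ ν * X * B ^ (1 - ν) + A ^ (1 - ν) * X * B ^ ν)

/-!
Diagonalize `A` and `B` by unitaries, with eigenvalues `aᵢ` and `bⱼ`, and put
`zᵢⱼ = log aᵢ - log bⱼ`. Up to a unitary factor on either side, which a unitarily invariant norm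
does not see, the matrix inside `heinzNorm N A B X (1 / 2 + s)` has the entries
`cosh (s zᵢⱼ) Yᵢⱼ`, where `Y` does not depend on `s`. It remains to see that
`N (cosh (s z) ⊙ Y) ≤ N (cosh (t z) ⊙ Y)` for `0 ≤ s ≤ t`; the other half of the statement is the
symmetry `ν ↔ 1 - ν`.

The Euler product `cosh (π w) = ∏ₖ (1 + 4 w² / (2 k + 1)²)` reduces this to a single quadratic
factor: `r ↦ N ((1 + r z²) ⊙ G)` must be monotone on `r ≥ 0`. This function is convex, so it is
enough that it is smallest at `r = 0` (`seminorm_le_diffSchur_one_add_sq`). There unitary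
invariance enters: multiplying the entries by `cos (ε zᵢⱼ)` is the average of two multiplications
by diagonal unitaries, hence a contraction (`diffSchur_cos_le`), and
`z² = lim 2 (1 - cos (ε z)) / ε²` as `ε → 0`.
-/

open Filter Topology

/-! ### Euler's product for the hyperbolic cosine -/

theorem tendsto_euler_sinh_prod (x : ℝ) :
    Tendsto (fun n : ℕ => Real.pi * x * ∏ j ∈ Finset.range n, (1 + x ^ 2 / ((j : ℝ) + 1) ^ 2))
      atTop (𝓝 (Real.sinh (Real.pi * x))) := by
  have h := (Complex.tendsto_euler_sin_prod (x * Complex.I)).mul_const (-Complex.I)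
  have h' := (Complex.continuous_re.tendsto _).comp h
  have e : Complex.sin (Real.pi * (x * Complex.I)) * -Complex.I
      = ((Real.sinh (Real.pi * x) : ℝ) : ℂ) := by
    rw [← mul_assoc, Complex.sin_mul_I]
    push_cast
    rw [mul_assoc]
    simp
  rw [e, Complex.ofReal_re] at h'
  refine h'.congr fun n => ?_
  have e2 : (Real.pi : ℂ) * (x * Complex.I) *
      (∏ j ∈ Finset.range n, (1 - (x * Complex.I) ^ 2 / ((j : ℂ) + 1) ^ 2)) * -Complex.I
      = ((Real.pi * x * ∏ j ∈ Finset.range n, (1 + x ^ 2 / ((j : ℝ) + 1) ^ 2) : ℝ) : ℂ) := by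
    push_cast
    have : ∀ j : ℕ, (1 : ℂ) - (x * Complex.I) ^ 2 / ((j : ℂ) + 1) ^ 2
        = 1 + (x : ℂ) ^ 2 / ((j : ℂ) + 1) ^ 2 := fun j => by
      rw [mul_pow, Complex.I_sq]; ring
    simp only [this]
    linear_combination (-(Real.pi : ℂ) * x *
      ∏ j ∈ Finset.range n, (1 + (x : ℂ) ^ 2 / ((j : ℂ) + 1) ^ 2)) * Complex.I_sq
  simp only [Function.comp_apply]
  rw [e2, Complex.ofReal_re]

/-- Partial products of the Euler product for `w ↦ cosh (π w)`. -/
noncomputable def coshProd (n : ℕ) (w : ℝ) : ℝ :=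
  ∏ j ∈ Finset.range n, (1 + 4 / (2 * (j : ℝ) + 1) ^ 2 * w ^ 2)

/-- Separating the odd from the even factors in the product for `sinh (2 π w)`; this is the finite
form of `sinh (2 π w) = 2 sinh (π w) cosh (π w)`. -/
theorem prod_sinh_two_mul (n : ℕ) (w : ℝ) :
    ∏ j ∈ Finset.range (2 * n), (1 + (2 * w) ^ 2 / ((j : ℝ) + 1) ^ 2)
      = (∏ j ∈ Finset.range n, (1 + w ^ 2 / ((j : ℝ) + 1) ^ 2)) * coshProd n w := by
  induction n with
  | zero => simp [coshProd]
  | succ n ih =>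
    have h1 : (2 * (n : ℝ) + 1) ≠ 0 := by positivity
    have h2 : ((n : ℝ) + 1) ≠ 0 := by positivity
    have h3 : (2 * (n : ℝ) + 1 + 1) = 2 * (n + 1) := by ring
    rw [show 2 * (n + 1) = 2 * n + 1 + 1 by ring, Finset.prod_range_succ, Finset.prod_range_succ,
      ih, coshProd, coshProd, Finset.prod_range_succ, Finset.prod_range_succ]
    push_cast
    rw [h3]
    field_simp
    ring

theorem tendsto_coshProd (w : ℝ) :
    Tendsto (fun n => coshProd n w) atTop (𝓝 (Real.cosh (Real.pi * w))) := by
  rcases eq_or_ne w 0 with rfl | hw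
  · simp [coshProd]
  have hs : Real.sinh (Real.pi * w) ≠ 0 := by
    rw [Ne, Real.sinh_eq_zero]
    exact mul_ne_zero Real.pi_ne_zero hw
  have h2n : Tendsto (fun n : ℕ => 2 * n) atTop atTop :=
    tendsto_id.const_mul_atTop' (by norm_num)
  have h := ((tendsto_euler_sinh_prod (2 * w)).comp h2n).div
    ((tendsto_euler_sinh_prod w).const_mul 2) (mul_ne_zero two_ne_zero hs)
  have e : Real.sinh (Real.pi * (2 * w)) / (2 * Real.sinh (Real.pi * w))
      = Real.cosh (Real.pi * w) := by
    rw [show Real.pi * (2 * w) = 2 * (Real.pi * w) by ring, Real.sinh_two_mul]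
    field_simp
  rw [e] at h
  refine h.congr fun n => ?_
  have hp : ∏ j ∈ Finset.range n, (1 + w ^ 2 / ((j : ℝ) + 1) ^ 2) ≠ 0 :=
    (Finset.prod_pos fun j _ => by positivity).ne'
  have hpi := Real.pi_ne_zero
  simp only [Function.comp_apply, Pi.div_apply]
  rw [prod_sinh_two_mul]
  field_simp

/-! ### Schur multipliers depending on a difference -/

variable {n : ℕ}

theorem Seminorm.continuous_matrix (N : Seminorm ℂ (Matrix (Fin n) (Fin n) ℂ)) :
    Continuous N := by
  refine Seminorm.continuous_of_continuousAt_zero ?_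
  have hb : ∀ M, N M ≤ ∑ i, ∑ j, ‖M i j‖ * N (Matrix.single i j 1) := fun M => by
    conv_lhs => rw [Matrix.matrix_eq_sum_single M]
    refine (Finset.le_sum_of_subadditive N (map_zero N).le (map_add_le_add N) _ _).trans
      (Finset.sum_le_sum fun i _ => ?_)
    refine (Finset.le_sum_of_subadditive N (map_zero N).le (map_add_le_add N) _ _).trans
      (Finset.sum_le_sum fun j _ => ?_)
    rw [← map_smul_eq_mul, Matrix.smul_single, smul_eq_mul, mul_one]
  have hc : Tendsto (fun M : Matrix (Fin n) (Fin n) ℂ =>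
      ∑ i, ∑ j, ‖M i j‖ * N (Matrix.single i j 1)) (𝓝 0) (𝓝 0) := by
    have : Continuous (fun M : Matrix (Fin n) (Fin n) ℂ =>
      ∑ i, ∑ j, ‖M i j‖ * N (Matrix.single i j 1)) := by fun_prop
    simpa using this.tendsto 0
  rw [ContinuousAt, map_zero]
  exact squeeze_zero (fun M => apply_nonneg N M) hb hc

/-- The Schur product of `G` with the matrix whose entries are `f (x i - y j)`. -/
noncomputable def diffSchur (x y : Fin n → ℝ) (f : ℝ → ℝ) (G : Matrix (Fin n) (Fin n) ℂ) :
    Matrix (Fin n) (Fin n) ℂ :=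
  Matrix.of fun i j => (f (x i - y j) : ℂ) * G i j

theorem diffSchur_diffSchur (x y : Fin n → ℝ) (f g : ℝ → ℝ) (G : Matrix (Fin n) (Fin n) ℂ) :
    diffSchur x y f (diffSchur x y g G) = diffSchur x y (fun z => f z * g z) G := by
  ext i j
  simp [diffSchur, mul_assoc]

theorem tendsto_seminorm_diffSchur (N : Seminorm ℂ (Matrix (Fin n) (Fin n) ℂ))
    (x y : Fin n → ℝ) {ι : Type*} {l : Filter ι} {f : ι → ℝ → ℝ} {g : ℝ → ℝ}
    (h : ∀ z, Tendsto (fun k => f k z) l (𝓝 (g z))) (G : Matrix (Fin n) (Fin n) ℂ) :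
    Tendsto (fun k => N (diffSchur x y (f k) G)) l (𝓝 (N (diffSchur x y g G))) := by
  refine (N.continuous_matrix.tendsto _).comp ?_
  refine tendsto_pi_nhds.2 fun i => tendsto_pi_nhds.2 fun j => ?_
  exact ((Complex.continuous_ofReal.tendsto _).comp (h (x i - y j))).mul_const _

theorem diagonal_exp_mem_unitaryGroup (x : Fin n → ℝ) :
    Matrix.diagonal (fun i => Complex.exp (x i * Complex.I)) ∈ Matrix.unitaryGroup (Fin n) ℂ := by
  rw [Matrix.mem_unitaryGroup_iff, Matrix.star_eq_conjTranspose, Matrix.diagonal_conjTranspose,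
    Matrix.diagonal_mul_diagonal, ← Matrix.diagonal_one]
  congr 1
  ext i
  simp only [Pi.star_apply, RCLike.star_def, ← Complex.exp_conj, ← Complex.exp_add]
  simp

/-- Multiplication of the entries by `cos (ε (x i - y j))` is the average of two multiplications by
diagonal unitaries from the left and from the right. -/
theorem diffSchur_cos_le {N : Seminorm ℂ (Matrix (Fin n) (Fin n) ℂ)}
    (hN : IsUnitarilyInvariantNorm N) (x y : Fin n → ℝ) (ε : ℝ) (G : Matrix (Fin n) (Fin n) ℂ) :
    N (diffSchur x y (fun z => Real.cos (ε * z)) G) ≤ N G := by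
  have e : diffSchur x y (fun z => Real.cos (ε * z)) G = (1 / 2 : ℂ) •
      (Matrix.diagonal (fun i => Complex.exp ((ε * x i : ℝ) * Complex.I)) * G *
        Matrix.diagonal (fun i => Complex.exp ((-(ε * y i) : ℝ) * Complex.I)) +
      Matrix.diagonal (fun i => Complex.exp ((-(ε * x i) : ℝ) * Complex.I)) * G *
        Matrix.diagonal (fun i => Complex.exp ((ε * y i : ℝ) * Complex.I))) := by
    ext i j
    simp only [diffSchur, Matrix.of_apply, Matrix.smul_apply, Matrix.add_apply,
      Matrix.mul_diagonal, Matrix.diagonal_mul, smul_eq_mul, Complex.ofReal_cos, Complex.cos]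
    have h1 : Complex.exp (((ε * (x i - y j) : ℝ) : ℂ) * Complex.I)
        = Complex.exp ((ε * x i : ℝ) * Complex.I) * Complex.exp ((-(ε * y j) : ℝ) * Complex.I) := by
      rw [← Complex.exp_add]; push_cast; ring_nf
    have h2 : Complex.exp (-((ε * (x i - y j) : ℝ) : ℂ) * Complex.I)
        = Complex.exp ((-(ε * x i) : ℝ) * Complex.I) * Complex.exp ((ε * y j : ℝ) * Complex.I) := by
      rw [← Complex.exp_add]; push_cast; ring_nf
    rw [h1, h2]
    ring
  rw [e, map_smul_eq_mul]
  have := map_add_le_add N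
    (Matrix.diagonal (fun i => Complex.exp ((ε * x i : ℝ) * Complex.I)) * G *
        Matrix.diagonal (fun i => Complex.exp ((-(ε * y i) : ℝ) * Complex.I)))
    (Matrix.diagonal (fun i => Complex.exp ((-(ε * x i) : ℝ) * Complex.I)) * G *
        Matrix.diagonal (fun i => Complex.exp ((ε * y i : ℝ) * Complex.I)))
  rw [hN.unitary_mul_mul _ (diagonal_exp_mem_unitaryGroup _) _ (diagonal_exp_mem_unitaryGroup _),
    hN.unitary_mul_mul _ (diagonal_exp_mem_unitaryGroup _) _ (diagonal_exp_mem_unitaryGroup _)]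
    at this
  have h2 : ‖(1 / 2 : ℂ)‖ = 1 / 2 := by norm_num
  rw [h2]
  linarith

theorem tendsto_cos_second_difference (z : ℝ) :
    Tendsto (fun ε : ℝ => 2 * (1 - Real.cos (ε * z)) / ε ^ 2) (𝓝[≠] 0) (𝓝 (z ^ 2)) := by
  -- `2 (1 - cos (ε z)) / ε ^ 2` is the square of `2 sin (ε z / 2) / ε`, a difference quotient.
  have hd : HasDerivAt (fun ε : ℝ => 2 * Real.sin (ε * z / 2)) z 0 := by
    have h := (((hasDerivAt_id' (0 : ℝ)).mul_const z).div_const 2).sin.const_mul 2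
    have e : 2 * (Real.cos (0 * z / 2) * (1 * z / 2)) = z := by
      rw [zero_mul, zero_div, Real.cos_zero]
      ring
    rwa [e] at h
  have h := (hasDerivAt_iff_tendsto_slope.1 hd).pow 2
  refine h.congr' ?_
  filter_upwards [self_mem_nhdsWithin] with ε hε
  have hε' : ε ≠ 0 := hε
  have hc : Real.cos (ε * z) = 1 - 2 * Real.sin (ε * z / 2) ^ 2 := by
    rw [show ε * z = 2 * (ε * z / 2) by ring, Real.cos_two_mul, Real.cos_sq']
    ring_nf
  rw [hc, slope_def_field]
  simp
  field_simp

/-- The minimality at `r = 0`: before the limit `ε → 0`, the matrix `G` is recovered from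
`(1 + c) G - c cos (ε z) ⊙ G` by adding back a contraction of `c G`. -/
theorem seminorm_le_diffSchur_one_add_sq {N : Seminorm ℂ (Matrix (Fin n) (Fin n) ℂ)}
    (hN : IsUnitarilyInvariantNorm N) (x y : Fin n → ℝ) {r : ℝ} (hr : 0 ≤ r)
    (G : Matrix (Fin n) (Fin n) ℂ) :
    N G ≤ N (diffSchur x y (fun z => 1 + r * z ^ 2) G) := by
  have ht : Tendsto (fun ε : ℝ => N (diffSchur x y
      (fun z => 1 + r * (2 * (1 - Real.cos (ε * z)) / ε ^ 2)) G)) (𝓝[≠] 0)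
      (𝓝 (N (diffSchur x y (fun z => 1 + r * z ^ 2) G))) :=
    tendsto_seminorm_diffSchur N x y
      (fun z => ((tendsto_cos_second_difference z).const_mul r).const_add 1) G
  refine ge_of_tendsto ht ?_
  filter_upwards [self_mem_nhdsWithin] with ε hε
  set M := diffSchur x y (fun z => 1 + r * (2 * (1 - Real.cos (ε * z)) / ε ^ 2)) G
  -- `M = (1 + c) G - c cos (ε z) ⊙ G`, and the subtracted term has norm at most `c N G`.
  set c : ℝ := 2 * r / ε ^ 2
  have hc : 0 ≤ c := by positivity
  have e : ((1 + c : ℝ) : ℂ) • G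
      = M + (c : ℂ) • diffSchur x y (fun z => Real.cos (ε * z)) G := by
    ext i j
    simp only [M, c, diffSchur, Matrix.of_apply, Matrix.smul_apply, Matrix.add_apply, smul_eq_mul]
    push_cast
    ring
  have h1 := map_add_le_add N M ((c : ℂ) • diffSchur x y (fun z => Real.cos (ε * z)) G)
  rw [← e, map_smul_eq_mul, map_smul_eq_mul, Complex.norm_of_nonneg hc,
    Complex.norm_of_nonneg (by positivity)] at h1
  have h2 := mul_le_mul_of_nonneg_left (diffSchur_cos_le hN x y ε G) hc
  linarith

theorem diffSchur_one_add_sq_mono {N : Seminorm ℂ (Matrix (Fin n) (Fin n) ℂ)}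
    (hN : IsUnitarilyInvariantNorm N) (x y : Fin n → ℝ) {r r' : ℝ} (hr : 0 ≤ r) (hrr : r ≤ r')
    (G : Matrix (Fin n) (Fin n) ℂ) :
    N (diffSchur x y (fun z => 1 + r * z ^ 2) G) ≤
      N (diffSchur x y (fun z => 1 + r' * z ^ 2) G) := by
  -- The matrix for `r` is a convex combination of `G` and the matrix for `r'`.
  rcases (hr.trans hrr).eq_or_lt with h0 | h0
  · have : r = r' := by linarith
    rw [this]
  have h0' : (r' : ℂ) ≠ 0 := by exact_mod_cast h0.ne'
  set l : ℝ := r / r'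
  have hl0 : 0 ≤ l := by positivity
  have hl1 : l ≤ 1 := (div_le_one h0).2 hrr
  have e : diffSchur x y (fun z => 1 + r * z ^ 2) G
      = ((1 - l : ℝ) : ℂ) • G + (l : ℂ) • diffSchur x y (fun z => 1 + r' * z ^ 2) G := by
    ext i j
    simp only [l, diffSchur, Matrix.of_apply, Matrix.smul_apply, Matrix.add_apply, smul_eq_mul]
    push_cast
    field_simp
    ring
  rw [e]
  refine (map_add_le_add N _ _).trans ?_
  rw [map_smul_eq_mul, map_smul_eq_mul, Complex.norm_of_nonneg hl0,
    Complex.norm_of_nonneg (by linarith)]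
  have := mul_le_mul_of_nonneg_left (seminorm_le_diffSchur_one_add_sq hN x y h0.le G)
    (by linarith : 0 ≤ 1 - l)
  linarith

/-- The factors of the two products are exchanged one at a time. -/
theorem diffSchur_coshProd_mono {N : Seminorm ℂ (Matrix (Fin n) (Fin n) ℂ)}
    (hN : IsUnitarilyInvariantNorm N) (x y : Fin n → ℝ) {s t : ℝ} (hs : 0 ≤ s) (hst : s ≤ t)
    (m : ℕ) (G : Matrix (Fin n) (Fin n) ℂ) :
    N (diffSchur x y (fun z => coshProd m (s * z)) G) ≤
      N (diffSchur x y (fun z => coshProd m (t * z)) G) := by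
  induction m generalizing G with
  | zero => simp [coshProd]
  | succ m ih =>
    set c : ℝ := 4 / (2 * (m : ℝ) + 1) ^ 2
    have hsucc : ∀ u z : ℝ,
        coshProd (m + 1) (u * z) = coshProd m (u * z) * (1 + c * u ^ 2 * z ^ 2) := fun u z => by
      rw [coshProd, Finset.prod_range_succ, coshProd]
      ring
    simp only [hsucc]
    calc N (diffSchur x y (fun z => coshProd m (s * z) * (1 + c * s ^ 2 * z ^ 2)) G)
        ≤ N (diffSchur x y (fun z => coshProd m (t * z))
            (diffSchur x y (fun z => 1 + c * s ^ 2 * z ^ 2) G)) := by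
          rw [← diffSchur_diffSchur]
          exact ih _
      _ = N (diffSchur x y (fun z => 1 + c * s ^ 2 * z ^ 2)
            (diffSchur x y (fun z => coshProd m (t * z)) G)) := by
          simp only [diffSchur_diffSchur, mul_comm]
      _ ≤ N (diffSchur x y (fun z => 1 + c * t ^ 2 * z ^ 2)
            (diffSchur x y (fun z => coshProd m (t * z)) G)) := by
          refine diffSchur_one_add_sq_mono hN x y (by positivity) ?_ _
          gcongr
      _ = N (diffSchur x y (fun z => coshProd m (t * z) * (1 + c * t ^ 2 * z ^ 2)) G) := by
          simp only [diffSchur_diffSchur, mul_comm]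

theorem diffSchur_cosh_mono {N : Seminorm ℂ (Matrix (Fin n) (Fin n) ℂ)}
    (hN : IsUnitarilyInvariantNorm N) (x y : Fin n → ℝ) {s t : ℝ} (hs : 0 ≤ s) (hst : s ≤ t)
    (G : Matrix (Fin n) (Fin n) ℂ) :
    N (diffSchur x y (fun z => Real.cosh (s * z)) G) ≤
      N (diffSchur x y (fun z => Real.cosh (t * z)) G) := by
  have key : ∀ u : ℝ, Tendsto
      (fun m => N (diffSchur x y (fun z => coshProd m (u / Real.pi * z)) G)) atTop
      (𝓝 (N (diffSchur x y (fun z => Real.cosh (u * z)) G))) := fun u => by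
    refine tendsto_seminorm_diffSchur N x y (fun z => ?_) G
    have h := tendsto_coshProd (u / Real.pi * z)
    rwa [show Real.pi * (u / Real.pi * z) = u * z by field_simp] at h
  exact le_of_tendsto_of_tendsto' (key s) (key t) fun m =>
    diffSchur_coshProd_mono hN x y (div_nonneg hs Real.pi_pos.le)
      (div_le_div_of_nonneg_right hst Real.pi_pos.le) m G

/-! ### Reduction to diagonal matrices -/

theorem Matrix.PosDef.rpow_eq {A : Matrix (Fin n) (Fin n) ℂ} (hA : A.PosDef) (p : ℝ) :
    A ^ p = (hA.isHermitian.eigenvectorUnitary : Matrix (Fin n) (Fin n) ℂ) *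
      Matrix.diagonal (fun i => ((hA.isHermitian.eigenvalues i ^ p : ℝ) : ℂ)) *
      star (hA.isHermitian.eigenvectorUnitary : Matrix (Fin n) (Fin n) ℂ) := by
  rw [CFC.rpow_eq_cfc_real hA.posSemidef.nonneg, hA.isHermitian.cfc_eq]
  rfl

/-- The matrix in the reduction to diagonal matrices that does not depend on the exponent: the entry
at `(i, j)` is `2 (aᵢ bⱼ) ^ (1 / 2)` times the entry of `X` in the eigenbases of `A` and `B`. The
factor `2` is the one of `2 cosh`. -/
noncomputable def heinzCore {A B : Matrix (Fin n) (Fin n) ℂ} (hA : A.PosDef) (hB : B.PosDef)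
    (X : Matrix (Fin n) (Fin n) ℂ) : Matrix (Fin n) (Fin n) ℂ :=
  Matrix.of fun i j =>
    ((2 * (hA.isHermitian.eigenvalues i ^ (1 / 2 : ℝ) *
      hB.isHermitian.eigenvalues j ^ (1 / 2 : ℝ)) : ℝ) : ℂ) *
    (star (hA.isHermitian.eigenvectorUnitary : Matrix (Fin n) (Fin n) ℂ) * X *
      (hB.isHermitian.eigenvectorUnitary : Matrix (Fin n) (Fin n) ℂ)) i j

theorem rpow_mul_rpow_add_eq_cosh {a b : ℝ} (ha : 0 < a) (hb : 0 < b) (s : ℝ) :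
    a ^ (1 / 2 + s) * b ^ (1 - (1 / 2 + s)) + a ^ (1 - (1 / 2 + s)) * b ^ (1 / 2 + s) =
      Real.cosh (s * (Real.log a - Real.log b)) *
        (2 * (a ^ (1 / 2 : ℝ) * b ^ (1 / 2 : ℝ))) := by
  simp only [Real.rpow_def_of_pos ha, Real.rpow_def_of_pos hb, Real.cosh_eq, ← Real.exp_add]
  have h : ∀ u v w : ℝ, (Real.exp u + Real.exp v) / 2 * (2 * Real.exp w)
      = Real.exp (u + w) + Real.exp (v + w) := fun u v w => by
    rw [Real.exp_add, Real.exp_add]; ring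
  rw [h]
  ring_nf

theorem heinzNorm_half_add {N : Seminorm ℂ (Matrix (Fin n) (Fin n) ℂ)}
    (hN : IsUnitarilyInvariantNorm N) {A B : Matrix (Fin n) (Fin n) ℂ} (hA : A.PosDef)
    (hB : B.PosDef) (X : Matrix (Fin n) (Fin n) ℂ) (s : ℝ) :
    heinzNorm N A B X (1 / 2 + s) =
      N (diffSchur (fun i => Real.log (hA.isHermitian.eigenvalues i))
        (fun j => Real.log (hB.isHermitian.eigenvalues j)) (fun z => Real.cosh (s * z))
        (heinzCore hA hB X)) := by
  set a := hA.isHermitian.eigenvalues with ha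
  set b := hB.isHermitian.eigenvalues with hb
  set U : Matrix (Fin n) (Fin n) ℂ := ↑hA.isHermitian.eigenvectorUnitary with hU
  set V : Matrix (Fin n) (Fin n) ℂ := ↑hB.isHermitian.eigenvectorUnitary with hV
  have hUm : U ∈ Matrix.unitaryGroup (Fin n) ℂ := hA.isHermitian.eigenvectorUnitary.2
  have hVm : star V ∈ Matrix.unitaryGroup (Fin n) ℂ :=
    (star hB.isHermitian.eigenvectorUnitary).2
  have e : A ^ (1 / 2 + s) * X * B ^ (1 - (1 / 2 + s)) +
      A ^ (1 - (1 / 2 + s)) * X * B ^ (1 / 2 + s)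
      = U * diffSchur (fun i => Real.log (a i)) (fun j => Real.log (b j))
        (fun z => Real.cosh (s * z)) (heinzCore hA hB X) * star V := by
    have e1 : diffSchur (fun i => Real.log (a i)) (fun j => Real.log (b j))
        (fun z => Real.cosh (s * z)) (heinzCore hA hB X) =
        Matrix.diagonal (fun i => ((a i ^ (1 / 2 + s) : ℝ) : ℂ)) * (star U * X * V) *
          Matrix.diagonal (fun i => ((b i ^ (1 - (1 / 2 + s)) : ℝ) : ℂ)) +
        Matrix.diagonal (fun i => ((a i ^ (1 - (1 / 2 + s)) : ℝ) : ℂ)) * (star U * X * V) *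
          Matrix.diagonal (fun i => ((b i ^ (1 / 2 + s) : ℝ) : ℂ)) := by
      ext i j
      have h := congrArg (fun u : ℝ => (u : ℂ))
        (rpow_mul_rpow_add_eq_cosh (hA.eigenvalues_pos i) (hB.eigenvalues_pos j) s)
      simp only [← ha, ← hb] at h
      simp only [diffSchur, heinzCore, Matrix.of_apply, Matrix.add_apply, Matrix.mul_diagonal,
        Matrix.diagonal_mul, ← ha, ← hb, ← hU, ← hV]
      rw [← mul_assoc, ← Complex.ofReal_mul, ← h]
      push_cast
      ring
    rw [e1]
    simp only [hA.rpow_eq, hB.rpow_eq, ← ha, ← hb, ← hU, ← hV, mul_add, add_mul, mul_assoc]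
  rw [heinzNorm, e, hN.unitary_mul_mul U hUm (star V) hVm]

theorem heinzNorm_one_sub (N : Seminorm ℂ (Matrix (Fin n) (Fin n) ℂ))
    (A B X : Matrix (Fin n) (Fin n) ℂ) (ν : ℝ) :
    heinzNorm N A B X (1 - ν) = heinzNorm N A B X ν := by
  rw [heinzNorm, heinzNorm, sub_sub_cancel, add_comm]

theorem monotoneOn_heinzNorm {N : Seminorm ℂ (Matrix (Fin n) (Fin n) ℂ)}
    (hN : IsUnitarilyInvariantNorm N) {A B : Matrix (Fin n) (Fin n) ℂ} (hA : A.PosDef)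
    (hB : B.PosDef) (X : Matrix (Fin n) (Fin n) ℂ) :
    MonotoneOn (heinzNorm N A B X) (Set.Ici (1 / 2)) := by
  intro ν₁ h₁ ν₂ _ h
  have e : ∀ ν : ℝ, ν = 1 / 2 + (ν - 1 / 2) := fun ν => by ring
  rw [e ν₁, e ν₂, heinzNorm_half_add hN hA hB, heinzNorm_half_add hN hA hB]
  exact diffSchur_cosh_mono hN _ _ (sub_nonneg.2 h₁) (sub_le_sub_right h _) _

theorem mainTheorem5 {n : ℕ} (N : Seminorm ℂ (Matrix (Fin n) (Fin n) ℂ))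
    (hN : IsUnitarilyInvariantNorm N) (A B X : Matrix (Fin n) (Fin n) ℂ)
    (hA : A.PosDef) (hB : B.PosDef) :
    AntitoneOn (heinzNorm N A B X) (Set.Iic (1 / 2)) ∧
      MonotoneOn (heinzNorm N A B X) (Set.Ici (1 / 2)) := by
  have hmono := monotoneOn_heinzNorm hN hA hB X
  refine ⟨fun ν₁ h₁ ν₂ h₂ h => ?_, hmono⟩
  rw [← heinzNorm_one_sub N A B X ν₁, ← heinzNorm_one_sub N A B X ν₂]
  simp only [Set.mem_Iic] at h₁ h₂
  exact hmono (by simp only [Set.mem_Ici]; linarith) (by simp only [Set.mem_Ici]; linarith)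
    (by linarith)
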